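/- A game of dimension $k$ is $G=(S_1,S_2,E,w)$, where $S=S_1\uplus S_2$ is a finite set of states, $E\subseteq S\times S$ is such that every state has a successor, and $w:E\to\mathbb{Z}^k$. Plays are infinite paths. A strategy of player $i$ is a function $\lambda_i:S^*S_i\to S$ with $(s,\lambda_i(\rho s))\in E$. It has finite memory if it is computed by a finite deterministic Moore machine, i.e. if there are a finite set $M$, $m_0\in M$, $\alpha_u:M\times S\to M$ and $\alpha_n:M\times S_i\to S$ such that $\lambda_i(\rho s)=\alpha_n(\hat\alpha_u(m_0,\rho),s)$ for all $\rho\in S^*$, $s\in S_i$, where $\hat\alpha_u$ is the extension of $\alpha_u$ to sequences. For a play $\pi=s_0s_1\dots$ and $1\le j\le k$ put $$\underline{\mathrm{MP}}(\pi)_j=\liminf_{n\to\infty}\frac1n\sum_{i<n}w(s_i,s_{i+1})_j,\qquad \overline{\mathrm{MP}}(\pi)_j=\limsup_{n\to\infty}\frac1n\sum_{i<n}w(s_i,s_{i+1})_j .$$ For $I,J\subseteq\{1,\dots,k\}$ and a threshold vector $v\in\mathbb{Q}^k$, the multi-mean-payoff objective $\mathrm{MeanPayoffInfSup}(I,J)$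 with threshold $v$ is the set of plays $\pi$ with $\underline{\mathrm{MP}}(\pi)_i\ge v_i$ for all $i\in I$ and $\overline{\mathrm{MP}}(\pi)_j\ge v_j$ for all $j\in J$. $\mathrm{MeanPayoffInf}$ is the case $I=\{1,\dots,k\}$, $J=\emptyset$, and $\mathrm{MeanPayoffSup}$ the case $I=\emptyset$, $J=\{1,\dots,k\}$; the threshold is $0$ unless another one is given. For an objective $\varphi$, let $\mathrm{Win}_1\varphi$ (resp. $\mathrm{Win}_2\lnot\varphi$) be the set of states from which player 1 (resp. player 2) has a strategy all of whose consistent plays lie in $\varphi$ (resp. outside $\varphi$). Define $\mathrm{Win}_1^{finite}\varphi$ and $\mathrm{Win}_2^{finite}\lnot\varphi$ in the same way with both players restricted to finite-memory strategies, and $\mathrm{Win}_1^{fin\text{-}inf}\varphi$ and $\mathrm{Win}_2^{fin\text{-}inf}\lnot\varphi$ with only the winning player restricted to finite-memory strategies. A game with objective $\varphi$ is determined if $S=\mathrm{Win}_1\varphi\cup\mathrm{Win}_2\lnot\varphi$, and determined under finite memory if $S=\mathrm{Win}_1^{finite}\varphi\cup\mathrm{Win}_2^{finite}\lnot\varphi$.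 The objective $\varphi$ is determined by finite memory if, for all games, $\mathrm{Win}_1\varphi=\mathrm{Win}_1^{fin\text{-}inf}\varphi$, $\mathrm{Win}_2\lnot\varphi=\mathrm{Win}_2^{fin\text{-}inf}\lnot\varphi$ and the game is determined. Determinacy and determinacy under finite memory coincide for $\varphi$ if, for all games, $\mathrm{Win}_1\varphi=\mathrm{Win}_1^{finite}\varphi$ and $\mathrm{Win}_2\lnot\varphi=\mathrm{Win}_2^{finite}\lnot\varphi$. **Theorem.** 1. For every game and every multi-mean-payoff objective $\varphi=\mathrm{MeanPayoffInfSup}(I,J)$, with any threshold $v\in\mathbb{Q}^k$, the game is determined under finite memory, and $\mathrm{Win}_1^{finite}\varphi=\mathrm{Win}_1^{fin\text{-}inf}\varphi$. 2. Multi-mean-payoff objectives are not determined by finite memory in general: for $\varphi=\mathrm{MeanPayoffInf}$ and for $\varphi=\mathrm{MeanPayoffSup}$ in dimension $2$ (threshold $0$), determinacy by finite memory fails, there is a game with a state from which player 1 has a winning strategy but no finite-memory winning strategy, and determinacy and determinacy under finite memory do not coincide. 3. In particular, consider the one-player game with two states $s_a,s_b$, both owned by player 1, with all four edges, and with weights $w(s_a,s_a)=(2,0)$,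 $w(s_b,s_b)=(0,2)$, $w(s_a,s_b)=w(s_b,s_a)=(0,0)$. From $s_a$, player 1 has a winning strategy for $\mathrm{MeanPayoffInf}$ with threshold $(1,1)$ and a winning strategy for $\mathrm{MeanPayoffSup}$ with threshold $(2,2)$, but no finite-memory strategy of player 1 is winning from $s_a$ for $\mathrm{MeanPayoffInf}$ with threshold $(1,1)$, for $\mathrm{MeanPayoffSup}$ with threshold $(1,1)$, or for $\mathrm{MeanPayoffSup}$ with threshold $(2,2)$. -/

import Mathlib

universe u

/-- The two players. -/
inductive Player where
  | one
  | two

/-- A multi-weighted two-player game structure of dimension `k` with state space `S`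
(assumed finite wherever it is used): `owner` gives the partition of `S` into `S₁` and `S₂`,
every state has a successor, and edges carry weights in `ℤ^k`
(the values of `weight` on pairs that are not edges are never used by a play). -/
structure Game (S : Type u) (k : ℕ) where
  owner : S → Player
  edge : S → S → Prop
  exists_succ : ∀ s, ∃ s', edge s s'
  weight : S → S → Fin k → ℤ

namespace Game

variable {S : Type u} {k : ℕ} (G : Game S k)

/-- `π` is a play in `G` (from its first state `π 0`). -/
def IsPlay (π : ℕ → S) : Prop := ∀ n, G.edge (π n) (π (n + 1))

/-- The energy level vector of the prefix `π 0, …, π n`. -/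
def energyLevel (π : ℕ → S) (n : ℕ) (i : Fin k) : ℤ :=
  ∑ j ∈ Finset.range n, G.weight (π j) (π (j + 1)) i

/-- The mean-payoff-inf value in dimension `i`. -/
noncomputable def meanPayoffInfValue (π : ℕ → S) (i : Fin k) : ℝ :=
  Filter.liminf (fun n : ℕ => (1 / (n : ℝ)) * (G.energyLevel π n i : ℝ)) Filter.atTop

/-- The mean-payoff-sup value in dimension `i`. -/
noncomputable def meanPayoffSupValue (π : ℕ → S) (i : Fin k) : ℝ :=
  Filter.limsup (fun n : ℕ => (1 / (n : ℝ)) * (G.energyLevel π n i : ℝ)) Filter.atTop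

/-- The multi-mean-payoff objective with threshold vector `v` (the basic case is `v = 0`):
mean-payoff-inf at least `v i` for `i ∈ I` and mean-payoff-sup at least `v j` for `j ∈ J`. -/
def meanPayoffInfSup (I J : Set (Fin k)) (v : Fin k → ℚ) : Set (ℕ → S) :=
  {π | G.IsPlay π ∧ (∀ i ∈ I, (v i : ℝ) ≤ G.meanPayoffInfValue π i) ∧
    (∀ j ∈ J, (v j : ℝ) ≤ G.meanPayoffSupValue π j)}

/-- The conjunction of all mean-payoff-inf objectives. -/
def meanPayoffInf (v : Fin k → ℚ) : Set (ℕ → S) := G.meanPayoffInfSup Set.univ ∅ v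

/-- The conjunction of all mean-payoff-sup objectives. -/
def meanPayoffSup (v : Fin k → ℚ) : Set (ℕ → S) := G.meanPayoffInfSup ∅ Set.univ v

/-- A strategy of player `p`: a function from `S^* · S_p` to `S` that follows edges.
`move ρ s h` is the choice after the history `ρ · s`, where `ρ` is listed in chronological order
and `s` is the current state. -/
structure Strategy (p : Player) where
  move : List S → (s : S) → G.owner s = p → S
  valid : ∀ ρ s h, G.edge s (move ρ s h)

variable {G}

/-- The strategy is encoded by a deterministic Moore machine `(M, m₀, αu, αn)`, `M` finite. -/
def Strategy.FiniteMemory {p : Player} (σ : G.Strategy p) : Prop :=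
  ∃ (M : Type) (_ : Finite M) (m₀ : M) (αu : M → S → M) (αn : M → (s : S) → G.owner s = p → S),
    ∀ ρ s h, σ.move ρ s h = αn (ρ.foldl αu m₀) s h

/-- The play `π` is consistent with the strategy `σ`. -/
def Strategy.Consistent {p : Player} (σ : G.Strategy p) (π : ℕ → S) : Prop :=
  ∀ (j : ℕ) (h : G.owner (π j) = p), π (j + 1) = σ.move ((List.range j).map π) (π j) h

variable (G)

/-- `σ` is winning from `s₀` for the player whose goal is `φ`. -/
def Wins {p : Player} (σ : G.Strategy p) (s₀ : S) (φ : Set (ℕ → S)) : Prop :=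
  ∀ π : ℕ → S, G.IsPlay π → π 0 = s₀ → σ.Consistent π → π ∈ φ

variable {G}

/-- The state chosen after the history `ρ · s` by its owner. -/
def nextState (σ₁ : G.Strategy .one) (σ₂ : G.Strategy .two) (ρ : List S) (s : S) : S :=
  match h : G.owner s with
  | .one => σ₁.move ρ s h
  | .two => σ₂.move ρ s h

/-- After `n` rounds: the list of the first `n` states and the current state. -/
def outcomeAux (σ₁ : G.Strategy .one) (σ₂ : G.Strategy .two) (s₀ : S) : ℕ → List S × S
  | 0 => ([], s₀)
  | n + 1 =>
    let c := outcomeAux σ₁ σ₂ s₀ n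
    (c.1 ++ [c.2], nextState σ₁ σ₂ c.1 c.2)

/-- The outcome from `s₀` of a pair of strategies. -/
def outcome (σ₁ : G.Strategy .one) (σ₂ : G.Strategy .two) (s₀ : S) (n : ℕ) : S :=
  (outcomeAux σ₁ σ₂ s₀ n).2

theorem outcomeAux_fst (σ₁ : G.Strategy .one) (σ₂ : G.Strategy .two) (s₀ : S) (n : ℕ) :
    (outcomeAux σ₁ σ₂ s₀ n).1 = (List.range n).map (outcome σ₁ σ₂ s₀) := by
  induction n with
  | zero => rfl
  | succ n ih => rw [List.range_succ, List.map_append, ← ih]; rfl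

theorem nextState_eq_iff (σ₁ : G.Strategy .one) (σ₂ : G.Strategy .two) (ρ : List S) (s t : S) :
    t = nextState σ₁ σ₂ ρ s ↔
      (∀ h, t = σ₁.move ρ s h) ∧ (∀ h, t = σ₂.move ρ s h) := by
  unfold nextState
  split
  · rename_i h
    exact ⟨fun e => ⟨fun _ => e, fun h' => by simp [h] at h'⟩, fun e => e.1 h⟩
  · rename_i h
    exact ⟨fun e => ⟨fun h' => by simp [h] at h', fun _ => e⟩, fun e => e.2 h⟩

/-- The outcome is the unique play from `s₀` that is consistent with both strategies. -/
theorem eq_outcome_iff (σ₁ : G.Strategy .one) (σ₂ : G.Strategy .two) (s₀ : S) (π : ℕ → S) :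
    π = outcome σ₁ σ₂ s₀ ↔
      G.IsPlay π ∧ π 0 = s₀ ∧ σ₁.Consistent π ∧ σ₂.Consistent π := by
  have key : ∀ n, outcome σ₁ σ₂ s₀ (n + 1) = nextState σ₁ σ₂
      ((List.range n).map (outcome σ₁ σ₂ s₀)) (outcome σ₁ σ₂ s₀ n) := fun n => by
    rw [← outcomeAux_fst]; rfl
  constructor
  · rintro rfl
    have h := fun n => (nextState_eq_iff σ₁ σ₂ _ _ _).1 (key n)
    refine ⟨fun n => ?_, rfl, fun n => (h n).1, fun n => (h n).2⟩
    cases ho : G.owner (outcome σ₁ σ₂ s₀ n) with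
    | one => rw [(h n).1 ho]; exact σ₁.valid _ _ _
    | two => rw [(h n).2 ho]; exact σ₂.valid _ _ _
  · rintro ⟨-, h0, h1, h2⟩
    funext n
    induction n using Nat.strong_induction_on with
    | _ n ih =>
      cases n with
      | zero => exact h0
      | succ n =>
        have e : (List.range n).map π = (List.range n).map (outcome σ₁ σ₂ s₀) :=
          List.map_congr_left fun m hm => ih m (by have := List.mem_range.1 hm; omega)
        rw [key n, ← e, ← ih n (Nat.lt_succ_self n)]
        exact (nextState_eq_iff _ _ _ _ _).2 ⟨h1 n, h2 n⟩

variable (G)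

/-- States from which player 1 has a winning strategy for `φ`. -/
def winOne (φ : Set (ℕ → S)) : Set S := {s₀ | ∃ σ : G.Strategy .one, G.Wins σ s₀ φ}

/-- States from which player 2 has a winning strategy for the complement of `φ`. -/
def winTwo (φ : Set (ℕ → S)) : Set S := {s₀ | ∃ σ : G.Strategy .two, G.Wins σ s₀ φᶜ}

/-- Player 1 wins for `φ`, both players being restricted to finite memory. -/
def winOneFinite (φ : Set (ℕ → S)) : Set S :=
  {s₀ | ∃ σ₁ : G.Strategy .one, σ₁.FiniteMemory ∧
    ∀ σ₂ : G.Strategy .two, σ₂.FiniteMemory → outcome σ₁ σ₂ s₀ ∈ φ}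

/-- Player 2 wins for the complement of `φ`, both players being restricted to finite memory. -/
def winTwoFinite (φ : Set (ℕ → S)) : Set S :=
  {s₀ | ∃ σ₂ : G.Strategy .two, σ₂.FiniteMemory ∧
    ∀ σ₁ : G.Strategy .one, σ₁.FiniteMemory → outcome σ₁ σ₂ s₀ ∉ φ}

/-- Player 1 wins for `φ` with finite memory against arbitrary strategies of player 2. -/
def winOneFinInf (φ : Set (ℕ → S)) : Set S :=
  {s₀ | ∃ σ₁ : G.Strategy .one, σ₁.FiniteMemory ∧
    ∀ σ₂ : G.Strategy .two, outcome σ₁ σ₂ s₀ ∈ φ}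

/-- Player 2 wins for the complement of `φ` with finite memory against arbitrary strategies
of player 1. -/
def winTwoFinInf (φ : Set (ℕ → S)) : Set S :=
  {s₀ | ∃ σ₂ : G.Strategy .two, σ₂.FiniteMemory ∧
    ∀ σ₁ : G.Strategy .one, outcome σ₁ σ₂ s₀ ∉ φ}

/-- Determinacy of the game `G` with objective `φ`. -/
def Determined (φ : Set (ℕ → S)) : Prop := G.winOne φ ∪ G.winTwo φ = Set.univ

/-- Determinacy under finite memory of the game `G` with objective `φ`. -/
def DeterminedUnderFiniteMemory (φ : Set (ℕ → S)) : Prop :=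
  G.winOneFinite φ ∪ G.winTwoFinite φ = Set.univ

end Game

/-- An objective of dimension `k`, given uniformly for all game structures. -/
abbrev Objective (k : ℕ) := ∀ S : Type, Game S k → Set (ℕ → S)

/-- Determinacy by finite memory holds for the objective `φ`. -/
def DeterminedByFiniteMemory {k : ℕ} (φ : Objective k) : Prop :=
  ∀ (S : Type) [Finite S] (G : Game S k),
    G.winOne (φ S G) = G.winOneFinInf (φ S G) ∧
    G.winTwo (φ S G) = G.winTwoFinInf (φ S G) ∧
    G.Determined (φ S G)

/-- Determinacy and determinacy under finite memory coincide for the objective `φ`. -/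
def DeterminaciesCoincide {k : ℕ} (φ : Objective k) : Prop :=
  ∀ (S : Type) [Finite S] (G : Game S k),
    G.winOne (φ S G) = G.winOneFinite (φ S G) ∧
    G.winTwo (φ S G) = G.winTwoFinite (φ S G)

/-- Infinite memory is needed in general for player 1 to win for the objective `φ`: in some game,
player 1 has a winning strategy from some state, but no winning strategy with finite memory. -/
def RequiresInfiniteMemory {k : ℕ} (φ : Objective k) : Prop :=
  ∃ (S : Type) (_ : Finite S) (G : Game S k) (s₀ : S),
    (∃ σ : G.Strategy .one, G.Wins σ s₀ (φ S G)) ∧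
    ¬ ∃ σ : G.Strategy .one, σ.FiniteMemory ∧ G.Wins σ s₀ (φ S G)

/-- The two-state one-player game: states `s_a = 0` and `s_b = 1`, all four edges,
weight `(2,0)` on the self-loop of `s_a`, `(0,2)` on that of `s_b`, `(0,0)` on the others. -/
def twoStateGame : Game (Fin 2) 2 where
  owner _ := .one
  edge _ _ := True
  exists_succ s := ⟨s, trivial⟩
  weight s t := if s = 0 ∧ t = 0 then ![2, 0] else if s = 1 ∧ t = 1 then ![0, 2] else ![0, 0]

/-! Scale the weights by a common denominator, subtract the thresholds and erase the unconstrained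
dimensions; this leaves an energy game with unknown initial credit, in which player 1 must keep all
sums bounded below.

If some credit wins, Dickson's lemma bounds the useful credits, so player 1 wins by remembering a
credit capped to a finite box. Bounded-below sums give every liminf its threshold, hence every
limsup too, against any opponent. If no credit wins, player 2 has a positional strategy forcing some
sum to be unbounded below (`exists_positional_energyWin`: at a state with two moves, one part of the
moves can be discarded). Against finite memory the play is then ultimately periodic, liminf and
limsup both equal the mean of the cycle, and meeting all thresholds would bound the sums below. This
gives determinacy under finite memory and the equality of player 1's regions.

For the negative part, an ultimately periodic play of the two-state game cannot reach mean 1 in both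
dimensions: a switch in the cycle costs weight, and no switch starves one dimension. Ever longer
blocks do reach it: quadratic block ends give liminf 1, doubly exponential ones limsup 2. Lowering
the weights by 1 moves the example to threshold 0. -/

open Filter Topology

namespace Game

variable {S : Type u} {k : ℕ}

/-! ### Energy games with unknown initial credit -/

section Energy

variable (owner : S → Player) (w : S → S → Fin k → ℤ)

/-- In each configuration (state and credit vector) of `Z` the credit is nonnegative, player 1 can
stay in `Z`, and player 2 cannot leave it, where both move along `R`. -/
def EnergySafe (R : S → S → Prop) (Z : Set (S × (Fin k → ℤ))) : Prop :=
  ∀ s c, (s, c) ∈ Z → 0 ≤ c ∧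
    (owner s = .one → ∃ t, R s t ∧ (t, c + w s t) ∈ Z) ∧
    (owner s = .two → ∀ t, R s t → (t, c + w s t) ∈ Z)

/-- The configurations from which player 1 can keep the credit nonnegative forever: the largest
safe set. -/
def energyWin (R : S → S → Prop) : Set (S × (Fin k → ℤ)) :=
  {p | ∃ Z, EnergySafe owner w R Z ∧ p ∈ Z}

variable {owner w} {R R₁ R₂ : S → S → Prop}

theorem EnergySafe.subset {Z : Set (S × (Fin k → ℤ))} (h : EnergySafe owner w R Z) :
    Z ⊆ energyWin owner w R := fun _ hp => ⟨Z, h, hp⟩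

/-- A union of safe sets is safe. Later inclusions into `energyWin` are coinductive: it is enough to
exhibit a safe set. -/
theorem energySafe_energyWin : EnergySafe owner w R (energyWin owner w R) := by
  rintro s c ⟨Z, hZ, hp⟩
  obtain ⟨h0, h1, h2⟩ := hZ s c hp
  refine ⟨h0, fun h => ?_, fun h t ht => hZ.subset (h2 h t ht)⟩
  obtain ⟨t, ht, hz⟩ := h1 h
  exact ⟨t, ht, hZ.subset hz⟩

/-- The upward closure of the winning set in the credit is safe. -/
theorem energyWin_mono_credit {s : S} {c d : Fin k → ℤ} (h : (s, c) ∈ energyWin owner w R)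
    (hcd : c ≤ d) : (s, d) ∈ energyWin owner w R := by
  refine EnergySafe.subset (Z := {p | ∃ c ≤ p.2, (p.1, c) ∈ energyWin owner w R}) ?_
    ⟨c, hcd, h⟩
  rintro s d ⟨c, hcd, h⟩
  obtain ⟨h0, h1, h2⟩ := energySafe_energyWin s c h
  refine ⟨h0.trans hcd, fun h => ?_, fun h t ht => ⟨_, add_le_add_left hcd _, h2 h t ht⟩⟩
  obtain ⟨t, ht, hz⟩ := h1 h
  exact ⟨t, ht, _, add_le_add_left hcd _, hz⟩

/-- If player 1 loses from `s` with `R₁`, then moves from `s` do not matter where he wins. -/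
theorem energyWin_subset_of_lost {s : S} (hR : ∀ x y, x ≠ s → (R₁ x y ↔ R x y))
    (hs : ∀ c, (s, c) ∉ energyWin owner w R₁) : energyWin owner w R₁ ⊆ energyWin owner w R := by
  refine EnergySafe.subset fun t c h => ?_
  have hts : t ≠ s := by rintro rfl; exact hs c h
  simpa only [hR t _ hts] using energySafe_energyWin t c h

/-- If player 1 wins from `s`, then he may use `R₁` until `s` is reached. -/
theorem energyWin_add_of_won {s : S} (hR : ∀ x y, x ≠ s → (R₁ x y ↔ R x y)) {d : Fin k → ℤ}
    (hs : (s, d) ∈ energyWin owner w R) {t : S} {c : Fin k → ℤ}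
    (ht : (t, c) ∈ energyWin owner w R₁) : (t, c + d) ∈ energyWin owner w R := by
  have hd : 0 ≤ d := (energySafe_energyWin s d hs).1
  -- The credit `d` stays in reserve while `R₁` is played; on reaching `s` it alone wins for `R`,
  -- and the play switches for good.
  refine EnergySafe.subset (Z := energyWin owner w R ∪
    {p | ∃ c, p.2 = c + d ∧ (p.1, c) ∈ energyWin owner w R₁}) ?_ (Or.inr ⟨c, rfl, ht⟩)
  have key : ∀ t c, (t, c) ∈ energyWin owner w R → _ := energySafe_energyWin
  rintro t c' (h | ⟨c, rfl, h⟩)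
  · obtain ⟨h0, h1, h2⟩ := key t c' h
    refine ⟨h0, fun h => ?_, fun h t ht => Or.inl (h2 h t ht)⟩
    obtain ⟨t, ht, hz⟩ := h1 h
    exact ⟨t, ht, Or.inl hz⟩
  · obtain ⟨h0, h1, h2⟩ := energySafe_energyWin t c h
    by_cases hts : t = s
    · subst hts
      obtain ⟨h0', h1, h2⟩ := key t (c + d)
        (energyWin_mono_credit hs (le_add_of_nonneg_left h0))
      refine ⟨h0', fun h => ?_, fun h t ht => Or.inl (h2 h t ht)⟩
      obtain ⟨t, ht, hz⟩ := h1 h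
      exact ⟨t, ht, Or.inl hz⟩
    · refine ⟨add_nonneg h0 hd, fun h => ?_, fun h t' ht =>
        Or.inr ⟨_, add_right_comm _ _ _, h2 h t' ((hR t t' hts).2 ht)⟩⟩
      obtain ⟨t', ht, hz⟩ := h1 h
      exact ⟨t', (hR t t' hts).1 ht, Or.inr ⟨_, add_right_comm _ _ _, hz⟩⟩

/-- If the moves of player 2 from `s` are split into two parts, player 1 can interleave a strategy
against each part. -/
theorem energyWin_add_of_split {s : S} (ho : owner s = .two)
    (hR₁ : ∀ x y, x ≠ s → (R₁ x y ↔ R x y)) (hR₂ : ∀ x y, x ≠ s → (R₂ x y ↔ R x y))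
    (hR : ∀ y, R s y → R₁ s y ∨ R₂ s y) {a b : Fin k → ℤ}
    (h₁ : (s, a) ∈ energyWin owner w R₁) (h₂ : (s, b) ∈ energyWin owner w R₂) :
    (s, a + b) ∈ energyWin owner w R := by
  -- Two separate credits: `a` pays for play along `R₁`, `b` for play along `R₂`. One is in use at
  -- the current state, the other suspended at `s`. Back at `s` both are winning there, and the move
  -- of player 2 selects which one is used next.
  refine EnergySafe.subset (Z := {p | ∃ a b, p.2 = a + b ∧
    ((p.1, a) ∈ energyWin owner w R₁ ∧ (s, b) ∈ energyWin owner w R₂ ∨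
     (s, a) ∈ energyWin owner w R₁ ∧ (p.1, b) ∈ energyWin owner w R₂)}) ?_
    ⟨a, b, rfl, Or.inl ⟨h₁, h₂⟩⟩
  rintro t c ⟨a, b, h, hab⟩
  obtain rfl : c = a + b := h
  have ha : 0 ≤ a := by rcases hab with h | h <;> exact (energySafe_energyWin _ _ h.1).1
  have hb : 0 ≤ b := by rcases hab with h | h <;> exact (energySafe_energyWin _ _ h.2).1
  refine ⟨add_nonneg ha hb, ?_⟩
  by_cases hts : t = s
  · subst hts
    have h₁ : (t, a) ∈ energyWin owner w R₁ := by rcases hab with h | h <;> exact h.1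
    have h₂ : (t, b) ∈ energyWin owner w R₂ := by rcases hab with h | h <;> exact h.2
    refine ⟨fun h => by simp [ho] at h, fun _ y hy => ?_⟩
    rcases hR y hy with hy | hy
    · exact ⟨_, _, add_right_comm _ _ _, Or.inl
        ⟨(energySafe_energyWin _ _ h₁).2.2 ho y hy, h₂⟩⟩
    · exact ⟨_, _, add_assoc _ _ _, Or.inr
        ⟨h₁, (energySafe_energyWin _ _ h₂).2.2 ho y hy⟩⟩
  · rcases hab with ⟨h₁, h₂⟩ | ⟨h₁, h₂⟩
    · obtain ⟨-, hone, htwo⟩ := energySafe_energyWin _ _ h₁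
      refine ⟨fun h => ?_, fun h y hy =>
        ⟨_, _, add_right_comm _ _ _, Or.inl ⟨htwo h y ((hR₁ t y hts).2 hy), h₂⟩⟩⟩
      obtain ⟨y, hy, hz⟩ := hone h
      exact ⟨y, (hR₁ t y hts).1 hy, _, _, add_right_comm _ _ _, Or.inl ⟨hz, h₂⟩⟩
    · obtain ⟨-, hone, htwo⟩ := energySafe_energyWin _ _ h₂
      refine ⟨fun h => ?_, fun h y hy =>
        ⟨_, _, add_assoc _ _ _, Or.inr ⟨h₁, htwo h y ((hR₂ t y hts).2 hy)⟩⟩⟩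
      obtain ⟨y, hy, hz⟩ := hone h
      exact ⟨y, (hR₂ t y hts).1 hy, _, _, add_assoc _ _ _, Or.inr ⟨h₁, hz⟩⟩

/-- One of the two parts suffices for player 2, from all states at once. -/
theorem energyWin_split {s : S} (ho : owner s = .two)
    (hR₁ : ∀ x y, x ≠ s → (R₁ x y ↔ R x y)) (hR₂ : ∀ x y, x ≠ s → (R₂ x y ↔ R x y))
    (hR : ∀ y, R s y → R₁ s y ∨ R₂ s y) :
    (∀ t c, (t, c) ∈ energyWin owner w R₁ → ∃ d, (t, d) ∈ energyWin owner w R) ∨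
    (∀ t c, (t, c) ∈ energyWin owner w R₂ → ∃ d, (t, d) ∈ energyWin owner w R) := by
  by_cases h : ∃ d, (s, d) ∈ energyWin owner w R
  · obtain ⟨d, hd⟩ := h
    exact Or.inl fun t c h => ⟨_, energyWin_add_of_won hR₁ hd h⟩
  -- With `s` lost for `R`, interleaving shows that `s` is lost for `R₁` or for `R₂`; the winning
  -- set of that part avoids `s`, so it is safe for `R`.
  by_cases h₁ : ∃ a, (s, a) ∈ energyWin owner w R₁
  · by_cases h₂ : ∃ b, (s, b) ∈ energyWin owner w R₂
    · obtain ⟨a, ha⟩ := h₁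
      obtain ⟨b, hb⟩ := h₂
      exact absurd ⟨_, energyWin_add_of_split ho hR₁ hR₂ hR ha hb⟩ h
    · push Not at h₂
      exact Or.inr fun t c h => ⟨c, energyWin_subset_of_lost hR₂ h₂ h⟩
  · push Not at h₁
    exact Or.inl fun t c h => ⟨c, energyWin_subset_of_lost hR₁ h₁ h⟩

/-- Positional strategies suffice for player 2 if the initial credit is unknown. -/
theorem exists_positional_energyWin [Finite S] (owner : S → Player) (w : S → S → Fin k → ℤ)
    (R : S → S → Prop) (hR : ∀ s, ∃ t, R s t) :
    ∃ R' : S → S → Prop, (∀ s t, R' s t → R s t) ∧ (∀ s, ∃ t, R' s t) ∧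
      (∀ s, owner s = .one → ∀ t, R s t → R' s t) ∧
      (∀ s, owner s = .two → ∀ t t', R' s t → R' s t' → t = t') ∧
      ∀ s c, (s, c) ∈ energyWin owner w R' → ∃ d, (s, d) ∈ energyWin owner w R := by
  -- Induction on the number of edges: at a state of player 2 with two moves, keep either `t₁` alone
  -- or everything but `t₁`.
  induction hn : {p : S × S | R p.1 p.2}.ncard using Nat.strong_induction_on generalizing R with
  | _ n ih =>
    by_cases hu : ∀ s, owner s = .two → ∀ t t', R s t → R s t' → t = t'
    · exact ⟨R, fun _ _ h => h, hR, fun _ _ _ h => h, hu, fun s c h => ⟨c, h⟩⟩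
    push Not at hu
    obtain ⟨s, ho, t₁, t₂, ht₁, ht₂, hne⟩ := hu
    have step : ∀ R' : S → S → Prop, (∀ x y, R' x y → R x y) → (∀ x, ∃ y, R' x y) →
        (∀ x, x ≠ s → ∀ y, R x y → R' x y) → (∃ t, R s t ∧ ¬ R' s t) →
        (∀ t c, (t, c) ∈ energyWin owner w R' → ∃ d, (t, d) ∈ energyWin owner w R) →
        ∃ R' : S → S → Prop, (∀ s t, R' s t → R s t) ∧ (∀ s, ∃ t, R' s t) ∧
          (∀ s, owner s = .one → ∀ t, R s t → R' s t) ∧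
          (∀ s, owner s = .two → ∀ t t', R' s t → R' s t' → t = t') ∧
          ∀ s c, (s, c) ∈ energyWin owner w R' → ∃ d, (s, d) ∈ energyWin owner w R := by
      rintro R' hle htot hsame ⟨t, hRt, hnt⟩ hwin
      have hlt : {p : S × S | R' p.1 p.2}.ncard < n := by
        rw [← hn]
        refine Set.ncard_lt_ncard ⟨fun p hp => hle _ _ hp, fun h => hnt ?_⟩ (Set.toFinite _)
        exact h (show (s, t) ∈ {p : S × S | R p.1 p.2} from hRt)
      obtain ⟨R'', h1, h2, h5, h3, h4⟩ := ih _ hlt R' htot rfl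
      refine ⟨R'', fun x y h => hle _ _ (h1 x y h), h2, fun x hx y hy =>
        h5 x hx y (hsame x (by rintro rfl; simp [ho] at hx) y hy), h3, fun x c h => ?_⟩
      obtain ⟨d, hd⟩ := h4 x c h
      exact hwin x d hd
    rcases energyWin_split (w := w) (R := R) (R₁ := fun x y => R x y ∧ (x = s → y = t₁))
      (R₂ := fun x y => R x y ∧ (x = s → y ≠ t₁)) ho (fun x y h => by simp [h])
      (fun x y h => by simp [h]) (fun y hy => by by_cases h : y = t₁ <;> simp [h, hy, ht₁])
      with h | h
    · refine step _ (fun x y h => h.1) (fun x => ?_)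
        (fun x hx y hy => ⟨hy, fun h => absurd h hx⟩) ⟨t₂, ht₂, fun h => hne (h.2 rfl).symm⟩ h
      by_cases hx : x = s
      · exact ⟨t₁, hx ▸ ht₁, fun _ => rfl⟩
      · exact (hR x).imp fun y hy => ⟨hy, fun h => absurd h hx⟩
    · refine step _ (fun x y h => h.1) (fun x => ?_)
        (fun x hx y hy => ⟨hy, fun h => absurd h hx⟩) ⟨t₁, ht₁, fun h => h.2 rfl rfl⟩ h
      by_cases hx : x = s
      · exact ⟨t₂, hx ▸ ht₂, fun _ => hne.symm⟩
      · exact (hR x).imp fun y hy => ⟨hy, fun h => absurd h hx⟩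

/-- Credits above some bound are not needed. -/
theorem exists_energyWin_cap [Finite S] (owner : S → Player) (w : S → S → Fin k → ℤ)
    (R : S → S → Prop) :
    ∃ B : ℕ, ∀ s c, (s, c) ∈ energyWin owner w R →
      (s, c ⊓ fun _ => (B : ℤ)) ∈ energyWin owner w R := by
  let A : S → Set (Fin k → ℕ) := fun s => {f | (s, fun i => (f i : ℤ)) ∈ energyWin owner w R}
  have hfin : {p : S × (Fin k → ℕ) | Minimal (· ∈ A p.1) p.2}.Finite := by
    have : {p : S × (Fin k → ℕ) | Minimal (· ∈ A p.1) p.2} ⊆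
        ⋃ s, (fun f => (s, f)) '' {f | Minimal (· ∈ A s) f} := by
      rintro ⟨s, f⟩ h
      exact Set.mem_iUnion.2 ⟨s, f, h, rfl⟩
    refine (Set.finite_iUnion fun s => Set.Finite.image _ ?_).subset this
    -- Dickson's lemma: antichains in `ℕ^k` are finite.
    exact (setOfPred_minimal_antichain _).finite_of_partiallyWellOrderedOn (Set.isPWO_of_wellQuasiOrderedLE _)
  obtain ⟨B, hB⟩ : ∃ B : ℕ, ∀ p ∈ {p : S × (Fin k → ℕ) | Minimal (· ∈ A p.1) p.2},
      ∀ i, p.2 i ≤ B := by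
    obtain ⟨b, hb⟩ := (hfin.image fun p => ∑ i, p.2 i).bddAbove
    exact ⟨b, fun p hp i => (Finset.single_le_sum (f := p.2) (fun _ _ => Nat.zero_le _)
      (Finset.mem_univ i)).trans (hb ⟨p, hp, rfl⟩)⟩
  refine ⟨B, fun s c h => ?_⟩
  have hc := (energySafe_energyWin _ _ h).1
  have hcA : (fun i => (c i).toNat) ∈ A s := by
    have : (fun i => ((c i).toNat : ℤ)) = c := funext fun i => Int.toNat_of_nonneg (hc i)
    change (s, fun i => ((c i).toNat : ℤ)) ∈ energyWin owner w R
    rwa [this]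
  -- A minimal winning credit below `c` is also below `B`, hence below the capped credit.
  obtain ⟨m, hm, hmin⟩ := exists_minimal_le_of_wellFoundedLT (· ∈ A s) _ hcA
  refine energyWin_mono_credit (show (s, fun i => (m i : ℤ)) ∈ _ from hmin.prop)
    (le_inf (fun i => ?_) fun i => Int.ofNat_le.2 (hB (s, m) hmin i))
  exact (Int.le_toNat (hc i)).1 (hm i)

end Energy

/-! ### Finite-memory strategies -/

section Memory

variable {G : Game S k}

/-- `FiniteMemory` wants its memory in `Type`, while machines built from `S` live in another
universe; a finite memory is transported to some `Fin n`. -/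
theorem Strategy.finiteMemory_of_machine {p : Player} (σ : G.Strategy p) {M : Type*} [Finite M]
    (m₀ : M) (αu : M → S → M) (αn : M → (s : S) → G.owner s = p → S)
    (h : ∀ ρ s hs, σ.move ρ s hs = αn (ρ.foldl αu m₀) s hs) : σ.FiniteMemory := by
  let e := Finite.equivFin M
  refine ⟨_, inferInstance, e m₀, fun x s => e (αu (e.symm x) s), fun x => αn (e.symm x), ?_⟩
  have key : ∀ (ρ : List S) m,
      ρ.foldl (fun x s => e (αu (e.symm x) s)) (e m) = e (ρ.foldl αu m) := by
    intro ρ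
    induction ρ with
    | nil => intro m; rfl
    | cons a ρ ih => intro m; simp [ih]
  intro ρ s hs
  simp only [h, key, e.symm_apply_apply]

theorem Strategy.finiteMemory_of_positional {p : Player} (σ : G.Strategy p) (f : S → S)
    (h : ∀ ρ s hs, σ.move ρ s hs = f s) : σ.FiniteMemory :=
  σ.finiteMemory_of_machine () (fun _ _ => ()) (fun _ s _ => f s) h

theorem foldl_map_range_succ {M : Type*} (α : M → S → M) (m₀ : M) (π : ℕ → S) (n : ℕ) :
    ((List.range (n + 1)).map π).foldl α m₀ = α (((List.range n).map π).foldl α m₀) (π n) := by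
  simp [List.range_succ]

/-- The outcome of two finite-memory strategies is ultimately periodic. -/
theorem outcome_ultimately_periodic [Finite S] {σ₁ : G.Strategy .one} {σ₂ : G.Strategy .two}
    (h₁ : σ₁.FiniteMemory) (h₂ : σ₂.FiniteMemory) (s₀ : S) :
    ∃ N P, 0 < P ∧ ∀ n, N ≤ n → outcome σ₁ σ₂ s₀ (n + P) = outcome σ₁ σ₂ s₀ n := by
  obtain ⟨-, -, c₁, c₂⟩ := (eq_outcome_iff σ₁ σ₂ s₀ _).1 rfl
  set π := outcome σ₁ σ₂ s₀
  obtain ⟨M₁, _, m₁, u₁, n₁, h₁⟩ := h₁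
  obtain ⟨M₂, _, m₂, u₂, n₂, h₂⟩ := h₂
  -- Both memories and the current state determine the future; by pigeonhole this finite data
  -- repeats.
  let f : ℕ → M₁ × M₂ × S := fun n =>
    (((List.range n).map π).foldl u₁ m₁, ((List.range n).map π).foldl u₂ m₂, π n)
  have step : ∀ m n, f m = f n → f (m + 1) = f (n + 1) := by
    intro m n h
    simp only [f, Prod.mk.injEq] at h ⊢
    obtain ⟨e1, e2, e3⟩ := h
    rw [foldl_map_range_succ, foldl_map_range_succ, foldl_map_range_succ, foldl_map_range_succ,
      e1, e2, e3]
    refine ⟨rfl, rfl, ?_⟩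
    cases ho : G.owner (π m) with
    | one =>
      rw [c₁ m ho, c₁ n (e3 ▸ ho), h₁, h₁, e1]
      congr 1
    | two =>
      rw [c₂ m ho, c₂ n (e3 ▸ ho), h₂, h₂, e2]
      congr 1
  obtain ⟨a, b, hab, hf⟩ := Finite.exists_ne_map_eq_of_infinite f
  wlog hlt : a < b generalizing a b
  · exact this b a hab.symm hf.symm (by omega)
  refine ⟨a, b - a, by omega, fun n hn => ?_⟩
  have key : ∀ j, f (a + j) = f (b + j) := by
    intro j
    induction j with
    | zero => exact hf
    | succ j ih => exact step _ _ ih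
  have := congrArg (fun x => x.2.2) (key (n - a))
  simp only [f] at this
  rw [show n + (b - a) = b + (n - a) by omega, ← this, show a + (n - a) = n by omega]

open Classical in
/-- Where player 1 wins with some credit, he can do so with finite memory. -/
theorem exists_finiteMemory_of_energyWin [Finite S] (G : Game S k) (w : S → S → Fin k → ℤ)
    {s₀ : S} {c₀ : Fin k → ℤ} (h₀ : (s₀, c₀) ∈ energyWin G.owner w G.edge) :
    ∃ σ : G.Strategy .one, σ.FiniteMemory ∧ ∃ B : ℤ, ∀ π, G.IsPlay π → π 0 = s₀ →
      σ.Consistent π → ∀ n i, -B ≤ ∑ j ∈ Finset.range n, w (π j) (π (j + 1)) i := by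
  obtain ⟨B, hB⟩ := exists_energyWin_cap G.owner w G.edge
  let b : Fin k → ℤ := fun _ => (B : ℤ)
  have hb : 0 ≤ b := fun _ => Int.natCast_nonneg B
  let C := Set.Icc (0 : Fin k → ℤ) b
  have : Finite C := (Set.finite_Icc _ _).to_subtype
  -- The join with `0` only makes `cap` total; winning credits are already nonnegative.
  let cap : (Fin k → ℤ) → C := fun c => ⟨(c ⊓ b) ⊔ 0, le_sup_right, sup_le inf_le_right hb⟩
  have hcap : ∀ s c, (s, c) ∈ energyWin G.owner w G.edge →
      (s, (cap c).1) ∈ energyWin G.owner w G.edge ∧ (cap c).1 ≤ c := by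
    intro s c h
    exact ⟨energyWin_mono_credit (hB s c h) le_sup_left,
      sup_le inf_le_left (energySafe_energyWin s c h).1⟩
  -- The history handed to the machine omits the current state, so the memory holds the previous
  -- state with its credit, and the present credit is computed on the fly; `none` is the empty
  -- history.
  let cur : Option (S × C) → S → C := fun m s => m.elim (cap c₀) fun p => cap (p.2.1 + w p.1 s)
  have hnext : ∀ s (c : C), ∃ t, G.edge s t ∧
      (G.owner s = .one → (s, c.1) ∈ energyWin G.owner w G.edge →
        (t, c.1 + w s t) ∈ energyWin G.owner w G.edge) := by
    intro s c
    by_cases h : G.owner s = .one ∧ (s, c.1) ∈ energyWin G.owner w G.edge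
    · obtain ⟨t, ht, hw⟩ := (energySafe_energyWin _ _ h.2).2.1 h.1
      exact ⟨t, ht, fun _ _ => hw⟩
    · obtain ⟨t, ht⟩ := G.exists_succ s
      exact ⟨t, ht, fun h1 h2 => absurd ⟨h1, h2⟩ h⟩
  choose next hedge hnext using hnext
  let αu : Option (S × C) → S → Option (S × C) := fun m s => some (s, cur m s)
  let σ : G.Strategy .one := {
    move := fun ρ s _ => next s (cur (ρ.foldl αu none) s)
    valid := fun ρ s _ => hedge _ _ }
  refine ⟨σ, σ.finiteMemory_of_machine none αu (fun m s _ => next s (cur m s))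
    (fun _ _ _ => rfl), ∑ i, |c₀ i|, ?_⟩
  intro π hπ h0 hσ
  let c : ℕ → C := fun n => cur (((List.range n).map π).foldl αu none) (π n)
  have hc : ∀ n, c (n + 1) = cap ((c n).1 + w (π n) (π (n + 1))) := by
    intro n
    simp only [c]
    rw [foldl_map_range_succ]
    rfl
  -- Capping only discards credit: the stored credit is winning and never exceeds the true one.
  have key : ∀ n, (π n, (c n).1) ∈ energyWin G.owner w G.edge ∧
      ∀ i, (c n).1 i ≤ c₀ i + ∑ j ∈ Finset.range n, w (π j) (π (j + 1)) i := by
    intro n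
    induction n with
    | zero =>
      have := hcap _ _ (h0 ▸ h₀ : (π 0, c₀) ∈ _)
      exact ⟨this.1, fun i => by
        rw [Finset.sum_range_zero, add_zero]
        exact this.2 i⟩
    | succ n ih =>
      have hw : (π (n + 1), (c n).1 + w (π n) (π (n + 1))) ∈ energyWin G.owner w G.edge := by
        cases ho : G.owner (π n) with
        | one =>
          rw [show π (n + 1) = next (π n) (c n) from hσ n ho]
          exact hnext _ _ ho ih.1
        | two => exact (energySafe_energyWin _ _ ih.1).2.2 ho _ (hπ n)
      obtain ⟨h1, h2⟩ := hcap _ _ hw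
      rw [hc]
      refine ⟨h1, fun i => (h2 i).trans ?_⟩
      have := ih.2 i
      rw [Finset.sum_range_succ, Pi.add_apply]
      linarith
  intro n i
  have h1 := (energySafe_energyWin _ _ (key n).1).1 i
  have h2 := (key n).2 i
  have h3 := Finset.single_le_sum (f := fun i => |c₀ i|) (fun _ _ => abs_nonneg _)
    (Finset.mem_univ i)
  have h4 := le_abs_self (c₀ i)
  simp only [Pi.zero_apply] at h1 h3
  linarith

/-- Where player 1 wins with no credit, player 2 has one positional strategy that makes the credit
fall below every bound. -/
theorem exists_positional_of_not_energyWin [Finite S] (G : Game S k) (w : S → S → Fin k → ℤ) :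
    ∃ σ : G.Strategy .two, σ.FiniteMemory ∧ ∀ π, G.IsPlay π → σ.Consistent π →
      (∀ c, (π 0, c) ∉ energyWin G.owner w G.edge) →
      ¬ ∃ B : Fin k → ℤ, ∀ n i, -B i ≤ ∑ j ∈ Finset.range n, w (π j) (π (j + 1)) i := by
  obtain ⟨R, hle, htot, hone, huniq, hwin⟩ :=
    exists_positional_energyWin G.owner w G.edge G.exists_succ
  choose f hf using htot
  let σ : G.Strategy .two := ⟨fun _ s _ => f s, fun _ s _ => hle _ _ (hf s)⟩
  refine ⟨σ, σ.finiteMemory_of_positional f fun _ _ _ => rfl, ?_⟩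
  rintro π hπ hσ hlost ⟨B, hB⟩
  have hR : ∀ n, R (π n) (π (n + 1)) := by
    intro n
    cases ho : G.owner (π n) with
    | one => exact hone _ ho _ (hπ n)
    | two => rw [hσ n ho]; exact hf _
  let c : ℕ → Fin k → ℤ := fun n i => B i + ∑ j ∈ Finset.range n, w (π j) (π (j + 1)) i
  have hc : ∀ n, c n + w (π n) (π (n + 1)) = c (n + 1) := by
    intro n
    funext i
    simp only [c, Pi.add_apply, Finset.sum_range_succ]
    ring
  -- Player 2 has no choice along `R`, so the configurations of this single play, started with
  -- credit `B`, already form a safe set.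
  have hsafe : EnergySafe G.owner w R (Set.range fun n => (π n, c n)) := by
    rintro s d ⟨n, h⟩
    obtain ⟨rfl, rfl⟩ := Prod.mk.inj h
    refine ⟨fun i => ?_, fun _ => ⟨_, hR n, n + 1, ?_⟩, fun ho t ht => ⟨n + 1, ?_⟩⟩
    · have := hB n i
      simp only [c, Pi.zero_apply]
      linarith
    · simp only [hc]
    · obtain rfl := huniq _ ho _ _ (hR n) ht
      simp only [hc]
  obtain ⟨d, hd⟩ := hwin _ _ (hsafe.subset ⟨0, rfl⟩)
  exact hlost d hd

end Memory

/-! ### Mean payoff of ultimately periodic plays -/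

/-- The partial sums of an ultimately periodic sequence are linear up to a bounded error. -/
theorem exists_abs_sum_range_sub_le {x : ℕ → ℤ} {N P : ℕ} (hP : 0 < P)
    (hx : ∀ n, N ≤ n → x (n + P) = x n) :
    ∃ C : ℤ, ∀ n : ℕ, |P * ∑ j ∈ Finset.range n, x j - n * ∑ j ∈ Finset.range P, x (N + j)| ≤ C := by
  set A := ∑ j ∈ Finset.range P, x (N + j) with hA
  have hwin : ∀ m, ∑ j ∈ Finset.range P, x (N + m + j) = A := by
    intro m
    induction m with
    | zero => rfl
    | succ m ih =>
      rw [← ih]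
      have h1 := Finset.sum_range_succ (fun j => x (N + m + j)) P
      have h2 := Finset.sum_range_succ' (fun j => x (N + m + j)) P
      rw [hx _ (Nat.le_add_right N m)] at h1
      have h3 : ∑ j ∈ Finset.range P, x (N + (m + 1) + j) =
          ∑ j ∈ Finset.range P, x (N + m + (j + 1)) :=
        Finset.sum_congr rfl fun j _ => congrArg x (by omega)
      rw [h3]
      simp only [Nat.add_zero] at h2
      linarith
  -- From `N` on, `f` has period `P`, since every window of length `P` has sum `A`; so its values
  -- before `N + P` bound it.
  let f : ℕ → ℤ := fun n => P * ∑ j ∈ Finset.range n, x j - n * A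
  have hf : ∀ n, N ≤ n → f (n + P) = f n := by
    intro n hn
    obtain ⟨m, rfl⟩ := Nat.exists_eq_add_of_le hn
    simp only [f, Finset.sum_range_add, hwin]
    push_cast
    ring
  refine ⟨∑ m ∈ Finset.range (N + P), |f m|, fun n => ?_⟩
  change |f n| ≤ _
  induction n using Nat.strong_induction_on with
  | _ n ih =>
    by_cases hn : n < N + P
    · exact Finset.single_le_sum (f := fun m => |f m|) (fun _ _ => abs_nonneg _)
        (Finset.mem_range.2 hn)
    · have := hf (n - P) (by omega)
      rw [Nat.sub_add_cancel (by omega)] at this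
      rw [this]
      exact ih _ (by omega)

theorem tendsto_mean_of_abs_le {E : ℕ → ℝ} {r C : ℝ} (h : ∀ n : ℕ, |E n - n * r| ≤ C) :
    Tendsto (fun n : ℕ => 1 / (n : ℝ) * E n) atTop (𝓝 r) := by
  rw [tendsto_iff_dist_tendsto_zero]
  refine squeeze_zero' (Eventually.of_forall fun _ => dist_nonneg) ?_
    (tendsto_const_div_atTop_nhds_zero_nat C)
  filter_upwards [eventually_gt_atTop 0] with n hn
  have hn' : (0 : ℝ) < n := by exact_mod_cast hn
  rw [Real.dist_eq, show 1 / (n : ℝ) * E n - r = (E n - n * r) / n by field_simp, abs_div,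
    abs_of_pos hn']
  gcongr
  exact h n

/-- On an ultimately periodic play, both values are the mean weight of the cycle. -/
theorem meanPayoffValue_of_ultimately_periodic {G : Game S k} {π : ℕ → S} {i : Fin k} {N P : ℕ}
    (hP : 0 < P) (hπ : ∀ n, N ≤ n → π (n + P) = π n) :
    G.meanPayoffInfValue π i =
      (∑ j ∈ Finset.range P, G.weight (π (N + j)) (π (N + j + 1)) i : ℤ) / P ∧
    G.meanPayoffSupValue π i =
      (∑ j ∈ Finset.range P, G.weight (π (N + j)) (π (N + j + 1)) i : ℤ) / P := by
  obtain ⟨C, hC⟩ := exists_abs_sum_range_sub_le (x := fun n => G.weight (π n) (π (n + 1)) i) hP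
    (N := N) fun n hn => by
      rw [hπ n hn, show n + P + 1 = n + 1 + P by omega, hπ (n + 1) (by omega)]
  set A := ∑ j ∈ Finset.range P, G.weight (π (N + j)) (π (N + j + 1)) i
  have hP' : (0 : ℝ) < P := by exact_mod_cast hP
  have := tendsto_mean_of_abs_le (E := fun n => (G.energyLevel π n i : ℝ)) (r := A / P)
    (C := C / P) fun n => by
      have h : |(P : ℝ) * G.energyLevel π n i - n * A| ≤ C := by exact_mod_cast hC n
      have e : (G.energyLevel π n i : ℝ) - n * (A / P) =
          (P * G.energyLevel π n i - n * A) / P := by field_simp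
      rw [e, abs_div, abs_of_pos hP']
      gcongr
  exact ⟨this.liminf_eq, this.limsup_eq⟩

/-! ### Bounds on mean-payoff values -/

section

variable [Finite S] (G : Game S k) (π : ℕ → S) (i : Fin k)

/-- There are finitely many weights. Comparing liminf and limsup in `ℝ` needs this boundedness. -/
theorem exists_abs_mean_le : ∃ C : ℝ, ∀ n : ℕ, |1 / (n : ℝ) * (G.energyLevel π n i : ℝ)| ≤ C := by
  obtain ⟨b, hb⟩ := (Set.finite_range fun p : S × S => |(G.weight p.1 p.2 i : ℝ)|).bddAbove
  have hb0 : 0 ≤ b := (abs_nonneg _).trans (hb ⟨(π 0, π 0), rfl⟩)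
  refine ⟨b, fun n => ?_⟩
  rcases Nat.eq_zero_or_pos n with rfl | hn
  · simpa using hb0
  have hn' : (0 : ℝ) < n := by exact_mod_cast hn
  rw [abs_mul, abs_of_pos (by positivity : (0 : ℝ) < 1 / n), one_div, inv_mul_le_iff₀ hn',
    energyLevel]
  push_cast
  refine (Finset.abs_sum_le_sum_abs _ _).trans ?_
  refine (Finset.sum_le_card_nsmul _ _ b fun j _ => hb ⟨(π j, π (j + 1)), rfl⟩).trans ?_
  simp

theorem isBoundedUnder_le_mean : IsBoundedUnder (· ≤ ·) atTop
    fun n : ℕ => 1 / (n : ℝ) * (G.energyLevel π n i : ℝ) := by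
  obtain ⟨C, hC⟩ := G.exists_abs_mean_le π i
  exact isBoundedUnder_of ⟨C, fun n => (abs_le.1 (hC n)).2⟩

theorem isBoundedUnder_ge_mean : IsBoundedUnder (· ≥ ·) atTop
    fun n : ℕ => 1 / (n : ℝ) * (G.energyLevel π n i : ℝ) := by
  obtain ⟨C, hC⟩ := G.exists_abs_mean_le π i
  exact isBoundedUnder_of ⟨-C, fun n => (abs_le.1 (hC n)).1⟩

theorem meanPayoffInfValue_le_meanPayoffSupValue :
    G.meanPayoffInfValue π i ≤ G.meanPayoffSupValue π i :=
  liminf_le_limsup (G.isBoundedUnder_le_mean π i) (G.isBoundedUnder_ge_mean π i)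

variable {G π i}

theorem le_meanPayoffInfValue {f : ℕ → ℝ} {r : ℝ} (hf : Tendsto f atTop (𝓝 r))
    (h : ∀ᶠ n : ℕ in atTop, f n ≤ 1 / (n : ℝ) * (G.energyLevel π n i : ℝ)) :
    r ≤ G.meanPayoffInfValue π i := by
  rw [← hf.liminf_eq]
  exact liminf_le_liminf h hf.isBoundedUnder_ge
    (G.isBoundedUnder_le_mean π i).isCoboundedUnder_ge

theorem le_meanPayoffInfValue_of_le {B r : ℝ}
    (h : ∀ n : ℕ, n * r - B ≤ (G.energyLevel π n i : ℝ)) : r ≤ G.meanPayoffInfValue π i := by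
  refine le_meanPayoffInfValue (f := fun n : ℕ => 1 / (n : ℝ) * (n * r - B))
    (tendsto_mean_of_abs_le (C := |B|) fun n => by simp) (Eventually.of_forall fun n => ?_)
  gcongr
  exact h n

/-- Frequently having a mean close to `r` bounds the mean-payoff-sup value from below. -/
theorem le_meanPayoffSupValue {r : ℝ} {m : ℕ → ℕ} (hm : Tendsto m atTop atTop) {f : ℕ → ℝ}
    (hf : Tendsto f atTop (𝓝 r))
    (h : ∀ n, f n ≤ 1 / (m n : ℝ) * (G.energyLevel π (m n) i : ℝ)) :
    r ≤ G.meanPayoffSupValue π i := by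
  refine le_of_forall_lt fun a ha => ?_
  obtain ⟨a', haa', ha'⟩ := exists_between ha
  refine haa'.trans_le (le_limsup_of_frequently_le ?_ (G.isBoundedUnder_le_mean π i))
  refine hm.frequently (Eventually.frequently ?_)
  filter_upwards [hf.eventually (lt_mem_nhds ha')] with n hn
  exact hn.le.trans (h n)

end

/-! ### Reduction to energy games -/

/-- Player 1 wins a multi-mean-payoff objective with finite memory against all strategies, or
player 2 wins with finite memory against all finite-memory strategies. -/
theorem mem_winOneFinInf_or_mem_winTwoFinite [Finite S] (G : Game S k) (I J : Set (Fin k))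
    (v : Fin k → ℚ) (s₀ : S) :
    s₀ ∈ G.winOneFinInf (G.meanPayoffInfSup I J v) ∨
      s₀ ∈ G.winTwoFinite (G.meanPayoffInfSup I J v) := by
  classical
  let d : ℕ := ∏ i, (v i).den
  have hd : 0 < d := Finset.prod_pos fun i _ => (v i).den_pos
  have hd' : (0 : ℝ) < d := by exact_mod_cast hd
  have ha : ∀ i, ∃ a : ℤ, (a : ℝ) = d * v i := by
    intro i
    obtain ⟨e, he⟩ := Finset.dvd_prod_of_mem (fun i => (v i).den) (Finset.mem_univ i)
    refine ⟨e * (v i).num, ?_⟩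
    have h1 : (v i : ℝ) * (v i).den = (v i).num := by exact_mod_cast Rat.mul_den_eq_num (v i)
    have h2 : (d : ℝ) = (v i).den * e := by exact_mod_cast he
    push_cast
    rw [h2, ← h1]
    ring
  choose a ha using ha
  -- Sums of `w` measure the excess over the threshold, scaled by `d`; zero weights keep the other
  -- dimensions from constraining the credit.
  let w : S → S → Fin k → ℤ := fun s t i => if i ∈ I ∪ J then d * G.weight s t i - a i else 0
  have hsum : ∀ (x : ℕ → S) n i, i ∈ I ∪ J →
      ((∑ j ∈ Finset.range n, w (x j) (x (j + 1)) i : ℤ) : ℝ) =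
        d * (G.energyLevel x n i - n * v i) := by
    intro x n i hi
    simp only [w, if_pos hi, Finset.sum_sub_distrib, ← Finset.mul_sum, energyLevel]
    push_cast
    simp [ha]
    ring
  by_cases h : ∃ c, (s₀, c) ∈ energyWin G.owner w G.edge
  · obtain ⟨c, hc⟩ := h
    obtain ⟨σ, hσ, B, hB⟩ := exists_finiteMemory_of_energyWin G w hc
    refine Or.inl ⟨σ, hσ, fun τ => ?_⟩
    obtain ⟨hp, h0, h1, -⟩ := (eq_outcome_iff σ τ s₀ _).1 rfl
    have hval : ∀ i ∈ I ∪ J, (v i : ℝ) ≤ G.meanPayoffInfValue (outcome σ τ s₀) i := by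
      intro i hi
      refine le_meanPayoffInfValue_of_le (B := B / d) fun n => ?_
      have h2 : ((-B : ℤ) : ℝ) ≤ _ := Int.cast_le.2 (hB _ hp h0 h1 n i)
      rw [hsum _ _ _ hi] at h2
      push_cast at h2
      have h3 : (B : ℝ) / d * d = B := div_mul_cancel₀ _ hd'.ne'
      nlinarith
    exact ⟨hp, fun i hi => hval i (Or.inl hi), fun i hi => (hval i (Or.inr hi)).trans
      (G.meanPayoffInfValue_le_meanPayoffSupValue _ i)⟩
  · push Not at h
    obtain ⟨τ, hτ, hlose⟩ := exists_positional_of_not_energyWin G w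
    refine Or.inr ⟨τ, hτ, fun σ hσ hmem => ?_⟩
    obtain ⟨hp, h0, -, h2⟩ := (eq_outcome_iff σ τ s₀ _).1 rfl
    obtain ⟨N, P, hP, hper⟩ := outcome_ultimately_periodic hσ hτ s₀
    set x := outcome σ τ s₀
    refine hlose x hp h2 (by rwa [h0]) ?_
    have hB : ∀ i, ∃ B : ℤ, ∀ n, -B ≤ ∑ j ∈ Finset.range n, w (x j) (x (j + 1)) i := by
      intro i
      by_cases hi : i ∈ I ∪ J
      swap
      · exact ⟨0, fun n => by simp only [w, if_neg hi]; simp⟩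
      obtain ⟨C, hC⟩ := exists_abs_sum_range_sub_le (x := fun n => w (x n) (x (n + 1)) i) hP
        (N := N) fun n hn => by
          rw [hper n hn, show n + P + 1 = n + 1 + P by omega, hper (n + 1) (by omega)]
      -- Both values equal the cycle mean here, so `I` and `J` impose the same condition.
      have hA : 0 ≤ ∑ j ∈ Finset.range P, w (x (N + j)) (x (N + j + 1)) i := by
        have hv : (v i : ℝ) ≤
            (∑ j ∈ Finset.range P, G.weight (x (N + j)) (x (N + j + 1)) i : ℤ) / P := by
          have := meanPayoffValue_of_ultimately_periodic (G := G) (i := i) hP hper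
          rcases hi with hi | hi
          · exact this.1 ▸ hmem.2.1 i hi
          · exact this.2 ▸ hmem.2.2 i hi
        rw [le_div_iff₀ (by exact_mod_cast hP)] at hv
        have := hsum (fun n => x (N + n)) P i hi
        rw [← Int.cast_nonneg_iff (R := ℝ)]
        refine le_of_le_of_eq (mul_nonneg hd'.le ?_) this.symm
        rw [mul_comm] at hv
        exact sub_nonneg.2 hv
      refine ⟨C, fun n => ?_⟩
      have h1 := (abs_le.1 (hC n)).1
      have h2 : 0 ≤ (n : ℤ) * ∑ j ∈ Finset.range P, w (x (N + j)) (x (N + j + 1)) i := by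
        positivity
      have h3 : -C ≤ P * ∑ j ∈ Finset.range n, w (x j) (x (j + 1)) i := by
        linarith
      have hC0 : 0 ≤ C := (abs_nonneg _).trans (hC 0)
      have hP1 : (1 : ℤ) ≤ P := by exact_mod_cast hP
      by_contra! hlt
      nlinarith
    choose B hB using hB
    exact ⟨B, fun n i => hB i n⟩

theorem winOneFinInf_subset_winOneFinite (G : Game S k) (φ : Set (ℕ → S)) :
    G.winOneFinInf φ ⊆ G.winOneFinite φ :=
  fun _ ⟨σ, hσ, h⟩ => ⟨σ, hσ, fun τ _ => h τ⟩

theorem determinedUnderFiniteMemory_meanPayoffInfSup [Finite S] (G : Game S k)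
    (I J : Set (Fin k)) (v : Fin k → ℚ) :
    G.DeterminedUnderFiniteMemory (G.meanPayoffInfSup I J v) :=
  Set.eq_univ_of_forall fun s => (G.mem_winOneFinInf_or_mem_winTwoFinite I J v s).imp_left
    fun h => G.winOneFinInf_subset_winOneFinite _ h

/-- Otherwise player 2 would have a finite-memory winning strategy, and the two finite-memory
winners could be played against each other. -/
theorem winOneFinite_eq_winOneFinInf_meanPayoffInfSup [Finite S] (G : Game S k)
    (I J : Set (Fin k)) (v : Fin k → ℚ) :
    G.winOneFinite (G.meanPayoffInfSup I J v) = G.winOneFinInf (G.meanPayoffInfSup I J v) := by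
  refine Set.Subset.antisymm (fun s hs => ?_) (G.winOneFinInf_subset_winOneFinite _)
  refine (G.mem_winOneFinInf_or_mem_winTwoFinite I J v s).resolve_right ?_
  rintro ⟨τ, hτ, h⟩
  obtain ⟨σ, hσ, h'⟩ := hs
  exact h σ hσ (h' τ hτ)

/-! ### The two-state game: infinite memory is needed -/

theorem meanPayoffInf_subset_meanPayoffSup {S : Type u} [Finite S] {k : ℕ} (G : Game S k)
    (v : Fin k → ℚ) : G.meanPayoffInf v ⊆ G.meanPayoffSup v :=
  fun π h => ⟨h.1, fun _ => False.elim, fun i _ => (h.2.1 i trivial).trans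
    (G.meanPayoffInfValue_le_meanPayoffSupValue π i)⟩

theorem Wins.outcome_mem {S : Type u} {k : ℕ} {G : Game S k} {σ : G.Strategy .one} {s₀ : S}
    {φ : Set (ℕ → S)} (h : G.Wins σ s₀ φ) (τ : G.Strategy .two) : outcome σ τ s₀ ∈ φ := by
  obtain ⟨hp, h0, h1, -⟩ := (eq_outcome_iff σ τ s₀ _).1 rfl
  exact h _ hp h0 h1

/-- The two-state game with all weights lowered by `c`. -/
def shiftedTwoStateGame (c : ℤ) : Game (Fin 2) 2 where
  owner _ := .one
  edge _ _ := True
  exists_succ s := ⟨s, trivial⟩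
  weight s t i := twoStateGame.weight s t i - c

theorem shiftedTwoStateGame_zero : shiftedTwoStateGame 0 = twoStateGame := by
  simp [shiftedTwoStateGame, twoStateGame]

theorem twoStateGame_weight (s t i : Fin 2) :
    twoStateGame.weight s t i = if s = i ∧ t = i then 2 else 0 := by
  revert s t i
  simp only [twoStateGame]
  decide

theorem energyLevel_shiftedTwoStateGame (c : ℤ) (π : ℕ → Fin 2) (n : ℕ) (i : Fin 2) :
    (shiftedTwoStateGame c).energyLevel π n i = twoStateGame.energyLevel π n i - n * c := by
  simp [energyLevel, shiftedTwoStateGame, Finset.sum_sub_distrib]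

/-- Player 1 can realize every sequence of states. -/
theorem mem_winOne_shiftedTwoStateGame {c : ℤ} {φ : Set (ℕ → Fin 2)} {x : ℕ → Fin 2}
    (hx : x ∈ φ) : x 0 ∈ (shiftedTwoStateGame c).winOne φ := by
  refine ⟨⟨fun ρ _ _ => x (ρ.length + 1), fun _ _ _ => trivial⟩, fun π _ h0 h => ?_⟩
  have : π = x := by
    funext n
    cases n with
    | zero => exact h0
    | succ n => simpa using h n rfl
  exact this ▸ hx

/-- Blocks of lengths `1, 3, 5, …`, alternating between the two states. -/
def sqrtSeq (n : ℕ) : Fin 2 := Fin.ofNat 2 n.sqrt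

/-- Block `m` occupies the indices from `m²` to `m² + 2m`, and each of its loops earns 2 in
dimension `m` mod 2. The final correction is forced at `m = 0`, where `(m - 1)²` is 1 but the level
is 0. -/
theorem energyLevel_sqrtSeq (i : Fin 2) (m r : ℕ) (hr : r ≤ 2 * m) :
    twoStateGame.energyLevel sqrtSeq (m * m + r) i =
      (if Fin.ofNat 2 m = i then (m - 1) ^ 2 + 2 * (r : ℤ) else (m : ℤ) ^ 2) -
        if i = 0 then 1 else 0 := by
  have hx : ∀ m r, r ≤ 2 * m → sqrtSeq (m * m + r) = Fin.ofNat 2 m := fun m r h => by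
    rw [sqrtSeq, Nat.sqrt_add_eq m (by omega)]
  have hsucc : ∀ n, twoStateGame.energyLevel sqrtSeq (n + 1) i =
      twoStateGame.energyLevel sqrtSeq n i +
        if sqrtSeq n = i ∧ sqrtSeq (n + 1) = i then 2 else 0 := fun n => by
    rw [energyLevel, Finset.sum_range_succ, twoStateGame_weight]
    rfl
  induction m generalizing r with
  | zero =>
    obtain rfl : r = 0 := by omega
    fin_cases i <;> simp [energyLevel]
  | succ m ihm =>
    induction r with
    | zero =>
      have e : (m + 1) * (m + 1) + 0 = m * m + 2 * m + 1 := by ring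
      have h1 := hx m (2 * m) le_rfl
      have h2 := hx (m + 1) 0 (Nat.zero_le _)
      -- The edge between blocks weighs 0, and the roles of the two formulas swap: `(m - 1)² + 4m =
      -- (m + 1)²` and `m² = ((m + 1) - 1)²`.
      have hne : ¬ (Fin.ofNat 2 m = i ∧ Fin.ofNat 2 (m + 1) = i) := by
        rintro ⟨rfl, h⟩
        have := congrArg Fin.val h
        simp only [Fin.ofNat] at this
        omega
      have hor : Fin.ofNat 2 m = i ∨ Fin.ofNat 2 (m + 1) = i := by
        have hi := i.isLt
        simp only [Fin.ext_iff, Fin.ofNat]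
        omega
      rw [e] at h2 ⊢
      rw [hsucc, ihm _ le_rfl, h1, h2, if_neg hne]
      rcases hor with h | h
      · rw [if_pos h, if_neg fun h' => hne ⟨h, h'⟩]
        push_cast
        ring
      · rw [if_pos h, if_neg fun h' => hne ⟨h', h⟩]
        push_cast
        ring
    | succ r ihr =>
      rw [← add_assoc, hsucc, ihr (by omega), hx _ _ (by omega), add_assoc, hx _ _ hr]
      simp only [and_self]
      split_ifs <;> push_cast <;> ring

theorem le_energyLevel_sqrtSeq (i : Fin 2) (n : ℕ) :
    (n : ℤ) - 2 * n.sqrt - 1 ≤ twoStateGame.energyLevel sqrtSeq n i := by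
  obtain ⟨r, hr⟩ := Nat.exists_eq_add_of_le (Nat.sqrt_le n)
  have h2 : r ≤ 2 * n.sqrt := by
    have := Nat.sqrt_le_add n
    omega
  have h := energyLevel_sqrtSeq i n.sqrt r h2
  rw [← hr] at h
  rw [h]
  zify at hr h2
  split_ifs <;> nlinarith

theorem zero_mem_winOne_meanPayoffInf {c : ℤ} {v : Fin 2 → ℚ} (hv : ∀ i, v i ≤ 1 - c) :
    (0 : Fin 2) ∈ (shiftedTwoStateGame c).winOne ((shiftedTwoStateGame c).meanPayoffInf v) := by
  refine mem_winOne_shiftedTwoStateGame (x := sqrtSeq)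
    ⟨fun _ => trivial, fun i _ => ?_, fun _ => False.elim⟩
  have hv' : (v i : ℝ) ≤ 1 - c := by exact_mod_cast hv i
  -- The lag `2√n + 1` is at most `3√n`; dividing by `n` gives `3 / √n`.
  refine hv'.trans (le_meanPayoffInfValue (f := fun n : ℕ => 1 - c - 3 / √(n : ℝ)) ?_ ?_)
  · have : Tendsto (fun n : ℕ => 3 / √(n : ℝ)) atTop (𝓝 0) :=
      (Real.tendsto_sqrt_atTop.comp tendsto_natCast_atTop_atTop).const_div_atTop 3
    simpa using this.const_sub (1 - (c : ℝ))
  · filter_upwards [eventually_gt_atTop 0] with n hn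
    have hn' : (1 : ℝ) ≤ n := by exact_mod_cast hn
    have h1 : ((n : ℝ)) - 2 * n.sqrt - 1 ≤ twoStateGame.energyLevel sqrtSeq n i := by
      exact_mod_cast le_energyLevel_sqrtSeq i n
    have h2 : (n.sqrt : ℝ) ≤ √(n : ℝ) := Real.nat_sqrt_le_real_sqrt
    have h3 : (1 : ℝ) ≤ √(n : ℝ) := Real.one_le_sqrt.2 hn'
    have h4 : √(n : ℝ) * √(n : ℝ) = n := Real.mul_self_sqrt (by linarith)
    rw [energyLevel_shiftedTwoStateGame, one_div, inv_mul_eq_div, le_div_iff₀ (by linarith)]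
    push_cast
    have h5 : 3 / √(n : ℝ) * n = 3 * √(n : ℝ) := by
      rw [← h4]
      field_simp
      rw [Real.sqrt_sq (by linarith)]
    rw [sub_mul, h5]
    linarith

/-- Blocks ending at `2 ^ 2 ^ m`, alternating between the two states. -/
def logSeq (n : ℕ) : Fin 2 := Fin.ofNat 2 (Nat.log 2 (Nat.log 2 n))

theorem le_energyLevel_logSeq (i : Fin 2) (m : ℕ) (hm : Fin.ofNat 2 m = i) :
    2 * ((2 ^ 2 ^ (m + 1) : ℕ) : ℤ) - 4 * ((2 ^ 2 ^ m : ℕ) : ℤ) ≤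
      twoStateGame.energyLevel logSeq (2 ^ 2 ^ (m + 1)) i := by
  have hx : ∀ j, 2 ^ 2 ^ m ≤ j → j < 2 ^ 2 ^ (m + 1) → logSeq j = i := by
    intro j h1 h2
    have hj : j ≠ 0 := by
      rintro rfl
      exact absurd h1 (not_le.2 (by positivity))
    have h3 := (Nat.le_log_iff_pow_le (by norm_num) hj).2 h1
    have h4 := (Nat.log_lt_iff_lt_pow (by norm_num) hj).2 h2
    have h5 : Nat.log 2 (Nat.log 2 j) = m :=
      (Nat.log_eq_iff (Or.inr ⟨by norm_num, by
        have : 0 < 2 ^ m := by positivity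
        omega⟩)).2 ⟨h3, h4⟩
    rw [logSeq, h5, hm]
  have hlt : 2 ^ 2 ^ m < 2 ^ 2 ^ (m + 1) :=
    Nat.pow_lt_pow_right (by norm_num) (Nat.pow_lt_pow_right (by norm_num) (by omega))
  have h1 : 1 ≤ 2 ^ 2 ^ m := Nat.one_le_two_pow
  generalize 2 ^ 2 ^ m = a at *
  generalize 2 ^ 2 ^ (m + 1) = b at *
  -- The edge at `b - 1` leaves the block. The `b - 1 - a` loops earn `2b - 2a - 2 ≥ 2b - 4a`, as `a
  -- ≥ 1`, and all other edges earn at least 0.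
  have hsub : Finset.Ico a (b - 1) ⊆ Finset.range b := fun j hj => by
    rw [Finset.mem_Ico] at hj
    rw [Finset.mem_range]
    omega
  have hle := Finset.sum_le_sum_of_subset_of_nonneg hsub
    (f := fun j => twoStateGame.weight (logSeq j) (logSeq (j + 1)) i) fun j _ _ => by
      rw [twoStateGame_weight]
      split_ifs <;> norm_num
  refine le_trans ?_ hle
  rw [Finset.sum_congr rfl (g := fun _ => (2 : ℤ)) fun j hj => by
    rw [Finset.mem_Ico] at hj
    rw [twoStateGame_weight, if_pos ⟨hx j (by omega) (by omega), hx _ (by omega) (by omega)⟩]]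
  simp only [Finset.sum_const, Nat.card_Ico, nsmul_eq_mul]
  omega

theorem zero_mem_winOne_meanPayoffSup {c : ℤ} {v : Fin 2 → ℚ} (hv : ∀ i, v i ≤ 2 - c) :
    (0 : Fin 2) ∈ (shiftedTwoStateGame c).winOne ((shiftedTwoStateGame c).meanPayoffSup v) := by
  have h0 : logSeq 0 = 0 := by simp [logSeq]
  rw [← h0]
  refine mem_winOne_shiftedTwoStateGame
    ⟨fun _ => trivial, fun _ => False.elim, fun i _ => ?_⟩
  have hv' : (v i : ℝ) ≤ 2 - c := by exact_mod_cast hv i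
  have hpow : Tendsto (fun n : ℕ => 2 ^ 2 ^ n) atTop atTop :=
    (tendsto_pow_atTop_atTop_of_one_lt (one_lt_two : 1 < 2)).comp
      (tendsto_pow_atTop_atTop_of_one_lt (one_lt_two : 1 < 2))
  have hidx : Tendsto (fun n : ℕ => 2 * n + i.val) atTop atTop :=
    tendsto_atTop_mono (fun n => by rw [id]; omega) tendsto_id
  -- Sample at the ends of the blocks spent in state `i`: a block starting at `a` ends at `a²`,
  -- where the unshifted mean is at least `2 - 4 / a`.
  refine hv'.trans (le_meanPayoffSupValue (m := fun n => 2 ^ 2 ^ (2 * n + i.val + 1))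
    (f := fun n => 2 - c - 4 / ((2 ^ 2 ^ (2 * n + i.val) : ℕ) : ℝ))
    (hpow.comp ((tendsto_add_atTop_nat 1).comp hidx)) ?_ fun n => ?_)
  · have : Tendsto (fun n : ℕ => 4 / ((2 ^ 2 ^ (2 * n + i.val) : ℕ) : ℝ)) atTop (𝓝 0) :=
      (tendsto_natCast_atTop_atTop.comp (hpow.comp hidx)).const_div_atTop 4
    simpa using this.const_sub (2 - (c : ℝ))
  · have hi : Fin.ofNat 2 (2 * n + i.val) = i := by
      have := i.isLt
      simp only [Fin.ext_iff, Fin.ofNat]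
      omega
    have h := le_energyLevel_logSeq i _ hi
    have hsq : 2 ^ 2 ^ (2 * n + i.val + 1) = 2 ^ 2 ^ (2 * n + i.val) * 2 ^ 2 ^ (2 * n + i.val) := by
      rw [← pow_add, pow_succ, mul_two]
    have hpos : 0 < 2 ^ 2 ^ (2 * n + i.val) := by positivity
    rw [energyLevel_shiftedTwoStateGame]
    rw [hsq] at h ⊢
    generalize 2 ^ 2 ^ (2 * n + i.val) = a at *
    have hpos' : (0 : ℝ) < a := by exact_mod_cast hpos
    have h' : 2 * ((a * a : ℕ) : ℝ) - 4 * a ≤ twoStateGame.energyLevel logSeq (a * a) i := by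
      exact_mod_cast h
    push_cast at h' ⊢
    rw [one_div, inv_mul_eq_div, le_div_iff₀ (by positivity)]
    have e : (2 - (c : ℝ) - 4 / a) * (a * a) = 2 * (a * a) - 4 * a - a * a * c := by
      field_simp
      ring
    rw [e]
    linarith

/-- Each step earns at most 2 over both dimensions together, and a switch earns 0. Cycle sums of at
least `P` in both dimensions thus exclude switches; but a constant cycle earns nothing in the other
dimension. -/
theorem not_mem_meanPayoffSup_of_ultimately_periodic {c : ℤ} {v : Fin 2 → ℚ}
    (hv : ∀ i, 1 - c ≤ v i) {π : ℕ → Fin 2} {N P : ℕ} (hP : 0 < P)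
    (hπ : ∀ n, N ≤ n → π (n + P) = π n) : π ∉ (shiftedTwoStateGame c).meanPayoffSup v := by
  rintro ⟨-, -, h⟩
  let x : Fin 2 → ℕ → ℤ := fun i j => twoStateGame.weight (π (N + j)) (π (N + j + 1)) i
  have hsum : ∀ i, (P : ℤ) ≤ ∑ j ∈ Finset.range P, x i j := by
    intro i
    have h1 := h i trivial
    rw [(meanPayoffValue_of_ultimately_periodic hP hπ).2,
      le_div_iff₀ (by exact_mod_cast hP)] at h1
    have h2 : (1 - c : ℝ) ≤ v i := by exact_mod_cast hv i
    have h3 : (1 - c : ℝ) * P ≤ v i * P := by gcongr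
    have h4 := h3.trans h1
    simp only [shiftedTwoStateGame, Finset.sum_sub_distrib, Finset.sum_const, Finset.card_range,
      nsmul_eq_mul] at h4
    have h5 : (1 - c) * (P : ℤ) ≤ ∑ j ∈ Finset.range P, x i j - P * c := by exact_mod_cast h4
    linarith
  have hle : ∀ j, x 0 j + x 1 j ≤ if π (N + j + 1) = π (N + j) then 2 else 0 := by
    intro j
    simp only [x, twoStateGame_weight]
    generalize π (N + j + 1) = t
    generalize π (N + j) = s
    revert s t
    decide
  by_cases hc : ∀ j, j < P → π (N + j + 1) = π (N + j)
  · have hconst : ∀ j, j ≤ P → π (N + j) = π N := by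
      intro j
      induction j with
      | zero => intro _; rfl
      | succ j ih => intro hj; rw [← add_assoc, hc j (by omega), ih (by omega)]
    obtain ⟨i, hi⟩ : ∃ i, π N ≠ i := (exists_ne (π N)).imp fun _ h => h.symm
    have h0 : ∑ j ∈ Finset.range P, x i j = 0 := Finset.sum_eq_zero fun j hj => by
      simp only [x, twoStateGame_weight]
      rw [hconst j (Finset.mem_range.1 hj).le, if_neg fun h => hi h.1]
    have := hsum i
    omega
  · push Not at hc
    obtain ⟨j, hj, hne⟩ := hc
    have hlt : ∑ j ∈ Finset.range P, (x 0 j + x 1 j) < ∑ j ∈ Finset.range P, (2 : ℤ) := by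
      refine Finset.sum_lt_sum (fun j _ => (hle j).trans (by split_ifs <;> norm_num))
        ⟨j, Finset.mem_range.2 hj, (hle j).trans_lt ?_⟩
      rw [if_neg hne]
      norm_num
    rw [Finset.sum_add_distrib, Finset.sum_const, Finset.card_range, nsmul_eq_mul] at hlt
    have h0 := hsum 0
    have h1 := hsum 1
    linarith

theorem exists_outcome_not_mem_meanPayoffSup {c : ℤ} {v : Fin 2 → ℚ} (hv : ∀ i, 1 - c ≤ v i)
    {σ : (shiftedTwoStateGame c).Strategy .one} (hσ : σ.FiniteMemory) :
    ∃ τ : (shiftedTwoStateGame c).Strategy .two, τ.FiniteMemory ∧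
      outcome σ τ 0 ∉ (shiftedTwoStateGame c).meanPayoffSup v := by
  -- Player 2 owns no state; any finite-memory strategy serves to form an outcome.
  let τ : (shiftedTwoStateGame c).Strategy .two := ⟨fun _ s _ => s, fun _ _ _ => trivial⟩
  have hτ : τ.FiniteMemory := τ.finiteMemory_of_positional id fun _ _ _ => rfl
  obtain ⟨N, P, hP, h⟩ := outcome_ultimately_periodic hσ hτ 0
  exact ⟨τ, hτ, not_mem_meanPayoffSup_of_ultimately_periodic hv hP h⟩

/-- Finite memory is insufficient for an objective that player 1 wins in a two-state game, and that
is contained in a mean-payoff-sup objective which no finite-memory strategy achieves. -/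
theorem infinite_memory_of_subset {φ : Objective 2} {c : ℤ} {v : Fin 2 → ℚ}
    (hv : ∀ i, 1 - c ≤ v i)
    (hφ : φ _ (shiftedTwoStateGame c) ⊆ (shiftedTwoStateGame c).meanPayoffSup v)
    (hwin : 0 ∈ (shiftedTwoStateGame c).winOne (φ _ (shiftedTwoStateGame c))) :
    ¬ DeterminedByFiniteMemory φ ∧ RequiresInfiniteMemory φ ∧ ¬ DeterminaciesCoincide φ := by
  refine ⟨fun h => ?_, ⟨_, inferInstance, _, 0, hwin, ?_⟩, fun h => ?_⟩
  · obtain ⟨σ, hσ, h⟩ := (h _ (shiftedTwoStateGame c)).1 ▸ hwin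
    obtain ⟨τ, -, hn⟩ := exists_outcome_not_mem_meanPayoffSup hv hσ
    exact hn (hφ (h τ))
  · rintro ⟨σ, hσ, h⟩
    obtain ⟨τ, -, hn⟩ := exists_outcome_not_mem_meanPayoffSup hv hσ
    exact hn (hφ (h.outcome_mem τ))
  · obtain ⟨σ, hσ, h⟩ := (h _ (shiftedTwoStateGame c)).1 ▸ hwin
    obtain ⟨τ, hτ, hn⟩ := exists_outcome_not_mem_meanPayoffSup hv hσ
    exact hn (hφ (h τ hτ))

end Game

theorem mainTheorem4 :
    -- determinacy under finite memory, and equality of the two winning regions of player 1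
    (∀ (S : Type u) [Finite S] (k : ℕ) (G : Game S k) (I J : Set (Fin k)) (v : Fin k → ℚ),
      G.DeterminedUnderFiniteMemory (G.meanPayoffInfSup I J v) ∧
      G.winOneFinite (G.meanPayoffInfSup I J v) = G.winOneFinInf (G.meanPayoffInfSup I J v)) ∧
    -- failure of determinacy by finite memory
    ¬ DeterminedByFiniteMemory (k := 2) (fun _ G => G.meanPayoffInf 0) ∧
    ¬ DeterminedByFiniteMemory (k := 2) (fun _ G => G.meanPayoffSup 0) ∧
    -- winning strategies in general require infinite memory
    RequiresInfiniteMemory (k := 2) (fun _ G => G.meanPayoffInf 0) ∧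
    RequiresInfiniteMemory (k := 2) (fun _ G => G.meanPayoffSup 0) ∧
    -- determinacy and determinacy under finite memory do not coincide
    ¬ DeterminaciesCoincide (k := 2) (fun _ G => G.meanPayoffInf 0) ∧
    ¬ DeterminaciesCoincide (k := 2) (fun _ G => G.meanPayoffSup 0) ∧
    -- the two-state example, from the state `s_a`
    (0 : Fin 2) ∈ twoStateGame.winOne (twoStateGame.meanPayoffInf (fun _ => 1)) ∧
    (0 : Fin 2) ∈ twoStateGame.winOne (twoStateGame.meanPayoffSup (fun _ => 2)) ∧
    (∀ σ : twoStateGame.Strategy .one, σ.FiniteMemory →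
      ¬ twoStateGame.Wins σ 0 (twoStateGame.meanPayoffInf (fun _ => 1)) ∧
      ¬ twoStateGame.Wins σ 0 (twoStateGame.meanPayoffSup (fun _ => 1)) ∧
      ¬ twoStateGame.Wins σ 0 (twoStateGame.meanPayoffSup (fun _ => 2))) := by
  have hinf := Game.infinite_memory_of_subset (φ := fun _ G => G.meanPayoffInf 0) (c := 1) (v := 0)
    (by simp) (Game.meanPayoffInf_subset_meanPayoffSup _ _)
    (Game.zero_mem_winOne_meanPayoffInf (by simp))
  have hsup := Game.infinite_memory_of_subset (φ := fun _ G => G.meanPayoffSup 0) (c := 1) (v := 0)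
    (by simp) subset_rfl (Game.zero_mem_winOne_meanPayoffSup (by norm_num))
  refine ⟨fun S _ k G I J v => ⟨G.determinedUnderFiniteMemory_meanPayoffInfSup I J v,
    G.winOneFinite_eq_winOneFinInf_meanPayoffInfSup I J v⟩, hinf.1, hsup.1, hinf.2.1, hsup.2.1,
    hinf.2.2, hsup.2.2, ?_⟩
  -- The original game is the shift by `c = 0`; failing limsup 1 also rules out liminf 1.
  rw [← Game.shiftedTwoStateGame_zero]
  refine ⟨Game.zero_mem_winOne_meanPayoffInf (by simp), Game.zero_mem_winOne_meanPayoffSup (by simp),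
    fun σ hσ => ?_⟩
  obtain ⟨τ, -, h1⟩ := Game.exists_outcome_not_mem_meanPayoffSup (v := fun _ => 1) (by simp) hσ
  obtain ⟨τ', -, h2⟩ := Game.exists_outcome_not_mem_meanPayoffSup (v := fun _ => 2) (by norm_num) hσ
  exact ⟨fun h => h1 (Game.meanPayoffInf_subset_meanPayoffSup _ _ (h.outcome_mem τ)),
    fun h => h1 (h.outcome_mem τ), fun h => h2 (h.outcome_mem τ')⟩
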